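/- **Proposition (Volterra prediction).** Fix $T>0$ and let $G=(G_t)_{t\in[0,T]}$ be a centered Gaussian process on a probability space with covariance function $R(t,s)=\mathrm{Cov}(G_t,G_s)$ and $\mathcal F^G_u=\sigma(G_r: r\le u)$. Write $\mathbf 1_t=\mathbf 1_{[0,t)}$; in accordance with this, for an increasing $v:[0,T]\to\mathbb R$ the symbol $\int_0^t\cdots\,dv$ denotes the Lebesgue–Stieltjes integral over $[0,t)$ (the choice of end point matters only if $v$ jumps at $t$). Let $\Lambda$ be the Hilbert space completion of the linear combinations of the $\mathbf 1_t$, $t\in[0,T]$, in the inner product $\langle \mathbf 1_t,\mathbf 1_s\rangle_\Lambda=R(t,s)$, let $\Lambda_u\subseteq\Lambda$ be the closed linear span of $\{\mathbf 1_r: r\le u\}$, and let $f\mapsto\int_0^T f\,dG$ be the isometry $\Lambda\to L^2(\mathbb P)$ extending $\mathbf 1_t\mapsto G_t$; for $f\in\Lambda_u$ it is also written $\int_0^u f\,dG$. Suppose that $G$ is a Gaussian Volterra process, that is: (i) there are an increasing function $v:[0,T]\to\mathbb R$ and a kernel $K:[0,T]^2\to\mathbb R$ with $K(t,s)=0$ for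 $t<s$ and $\int_0^tK(t,x)^2\,dv(x)<\infty$ for all $t$, such that $$R(t,s)=\int_0^{t\wedge s}K(t,x)K(s,x)\,dv(x)\qquad (s,t\in[0,T]);$$ (ii) if $\mathrm K^*:\Lambda\to L^2([0,T],dv)$ denotes the isometry extending $\mathbf 1_t\mapsto K(t,\cdot)\mathbf 1_{[0,t)}$ (this is $K(t,\cdot)$ unless $v$ jumps at $t$), then for every $t\in[0,T]$ the equation $\mathrm K^*[K^{-1}(t,\cdot)]=\mathbf 1_t$ has a solution $K^{-1}(t,\cdot)\in\Lambda_t$. Let $u\le s\le t\le T$. Then $\mathbf 1_u\,[K(t,\cdot)-K(u,\cdot)]$ lies in the range of $\mathrm K^*$, and $$\Psi(t,\cdot\,|u):=(\mathrm K^*)^{-1}\big[\mathbf 1_u\,(K(t,\cdot)-K(u,\cdot))\big]$$ belongs to $\Lambda_u$. Moreover, almost surely, $$\hat m_t(u):=\mathbb E[G_t\,|\,\mathcal F^G_u]=G_u+\int_0^u\Psi(t,x|u)\,dG_x,$$ $$\hat R(t,s|u):=\mathrm{Cov}[G_t,G_s\,|\,\mathcal F^G_u]=R(t,s)-\int_0^uK(t,x)K(s,x)\,dv(x),$$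 and the conditional law of $G_t$ given $\mathcal F^G_u$ is the normal distribution with mean $\hat m_t(u)$ and variance $\hat R(t,t|u)\ge 0$ (the point mass at $\hat m_t(u)$ if this variance is $0$, for instance if $u=t$). -/

import Mathlib

open MeasureTheory ProbabilityTheory
open scoped ENNReal RealInnerProductSpace

noncomputable section

namespace Volterra

/-! ### The space of Wiener integrands -/

section Integrands

variable {ι : Type*} {R : Matrix ι ι ℝ}

/-- The bilinear form `∑ aᵢ bⱼ R tᵢ sⱼ` of `f = ∑ aᵢ 1_{tᵢ}` and `g = ∑ bⱼ 1_{sⱼ}`. -/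
def form (R : Matrix ι ι ℝ) (f g : ι →₀ ℝ) : ℝ :=
  f.sum fun i x => g.sum fun j y => x * R i j * y

lemma form_comm (hR : R.PosSemidef) (f g : ι →₀ ℝ) : form R g f = form R f g := by
  rw [form, form, Finsupp.sum_comm]
  simp only [Finsupp.sum]
  refine Finset.sum_congr rfl fun i _ => Finset.sum_congr rfl fun j _ => ?_
  have h := hR.1.apply i j
  simp only [star_trivial] at h
  rw [h]; ring

lemma form_add_left (f g k : ι →₀ ℝ) : form R (f + g) k = form R f k + form R g k := by
  rw [form, Finsupp.sum_add_index'] <;> simp [form, ← Finsupp.sum_add, add_mul]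

lemma form_smul_left (f g : ι →₀ ℝ) (r : ℝ) : form R (r • f) g = r * form R f g := by
  rw [form, Finsupp.sum_smul_index] <;> simp [form, Finsupp.mul_sum, mul_assoc]

lemma form_linearCombination {H : Type*} [NormedAddCommGroup H] [InnerProductSpace ℝ H]
    (φ : ι → H) (hφ : ∀ t s, ⟪φ t, φ s⟫ = R t s) (f g : ι →₀ ℝ) :
    ⟪Finsupp.linearCombination ℝ φ f, Finsupp.linearCombination ℝ φ g⟫ = form R f g := by
  simp only [Finsupp.linearCombination_apply, Finsupp.sum, sum_inner, inner_sum, form,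
    real_inner_smul_left, real_inner_smul_right, hφ]
  rw [Finset.sum_comm]
  refine Finset.sum_congr rfl fun i _ => Finset.sum_congr rfl fun j _ => ?_
  ring

/-- Elementary integrands: formal linear combinations `∑ aᵢ 1_{tᵢ}` of the indicators
`1_t = 1_{[0,t)}`. The positive semidefinite function `R` only serves to carry the inner product
`⟪1_t, 1_s⟫ = R t s` below. (Elementary integrands of seminorm `0` are identified with `0` in the
completion; this includes `1_0 = 0`, as `R 0 0 = 0` for the processes considered.) -/
def Elementary (_hR : R.PosSemidef) : Type _ := ι →₀ ℝ

instance (hR : R.PosSemidef) : AddCommGroup (Elementary hR) :=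
  inferInstanceAs (AddCommGroup (ι →₀ ℝ))

instance (hR : R.PosSemidef) : Module ℝ (Elementary hR) :=
  inferInstanceAs (Module ℝ (ι →₀ ℝ))

/-- The semi-inner product `⟪∑ aᵢ 1_{tᵢ}, ∑ bⱼ 1_{sⱼ}⟫ = ∑ aᵢ bⱼ R tᵢ sⱼ`. -/
instance (hR : R.PosSemidef) : PreInnerProductSpace.Core ℝ (Elementary hR) where
  inner f g := form R f g
  conj_inner_symm f g := form_comm hR f g
  re_inner_nonneg f := hR.2 f
  add_left f g k := form_add_left (R := R) f g k
  smul_left f g r := form_smul_left (R := R) f g r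

instance (hR : R.PosSemidef) : SeminormedAddCommGroup (Elementary hR) :=
  InnerProductSpace.Core.toSeminormedAddCommGroup (𝕜 := ℝ)

instance (hR : R.PosSemidef) : InnerProductSpace ℝ (Elementary hR) := .ofCore _

/-- The space `Λ` of Wiener integrands: the Hilbert space obtained by completing the elementary
integrands in the inner product `⟪1_t, 1_s⟫ = R t s`. -/
abbrev Lambda (hR : R.PosSemidef) : Type _ := UniformSpace.Completion (Elementary hR)

/-- The indicator `1_t` as an elementary integrand. -/
def elemInd (hR : R.PosSemidef) (t : ι) : Elementary hR := Finsupp.single t (1 : ℝ)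

/-- The indicator `1_t` as an element of `Λ`. -/
def ind (hR : R.PosSemidef) (t : ι) : Lambda hR := (elemInd hR t : Lambda hR)

lemma inner_ind (hR : R.PosSemidef) (t s : ι) : ⟪ind hR t, ind hR s⟫ = R t s := by
  rw [ind, ind, UniformSpace.Completion.inner_coe]
  change form R (Finsupp.single t 1) (Finsupp.single s 1) = _
  simp [form]

/-- `Λ_t`, the integrands on `[0,t]`: the closed linear span of the `1_r` with `r ≤ t`. -/
def LambdaUpTo [Preorder ι] (hR : R.PosSemidef) (t : ι) : Submodule ℝ (Lambda hR) :=
  (Submodule.span ℝ (ind hR '' Set.Iic t)).topologicalClosure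

variable {H : Type*} [NormedAddCommGroup H] [InnerProductSpace ℝ H]

/-- The linear extension of `1_t ↦ φ t` to elementary integrands. -/
def elemLift (hR : R.PosSemidef) (φ : ι → H) (hφ : ∀ t s, ⟪φ t, φ s⟫ = R t s) :
    Elementary hR →ₗᵢ[ℝ] H where
  toLinearMap := (Finsupp.linearCombination ℝ φ : (ι →₀ ℝ) →ₗ[ℝ] H)
  norm_map' f := by
    have h : ⟪Finsupp.linearCombination ℝ φ f, Finsupp.linearCombination ℝ φ f⟫
        = ⟪f, f⟫ := form_linearCombination φ hφ f f
    rw [@norm_eq_sqrt_real_inner (Elementary hR), ← h]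
    exact norm_eq_sqrt_real_inner _

/-- The isometric extension to `Λ` of the relation `1_t ↦ φ t`, where `⟪φ t, φ s⟫ = R t s`. -/
def lift [CompleteSpace H] (hR : R.PosSemidef) (φ : ι → H)
    (hφ : ∀ t s, ⟪φ t, φ s⟫ = R t s) : Lambda hR →ₗᵢ[ℝ] H where
  toLinearMap := ((elemLift hR φ hφ).toContinuousLinearMap.extend
    (UniformSpace.Completion.toComplL (𝕜 := ℝ) (E := Elementary hR))).toLinearMap
  norm_map' f := by
    have key : ∀ e : Elementary hR, (elemLift hR φ hφ).toContinuousLinearMap.extend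
        (UniformSpace.Completion.toComplL (𝕜 := ℝ) (E := Elementary hR)) (e : Lambda hR)
        = elemLift hR φ hφ e := fun e =>
      ContinuousLinearMap.extend_eq _ UniformSpace.Completion.denseRange_coe
        (UniformSpace.Completion.isUniformInducing_coe _) e
    change ‖(elemLift hR φ hφ).toContinuousLinearMap.extend
        (UniformSpace.Completion.toComplL (𝕜 := ℝ) (E := Elementary hR)) f‖ = ‖f‖
    refine UniformSpace.Completion.induction_on f ?_ fun e => ?_
    · exact isClosed_eq (by fun_prop) (by fun_prop)
    · rw [key, LinearIsometry.norm_map, UniformSpace.Completion.norm_coe]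

lemma lift_ind [CompleteSpace H] (hR : R.PosSemidef) (φ : ι → H)
    (hφ : ∀ t s, ⟪φ t, φ s⟫ = R t s) (t : ι) : lift hR φ hφ (ind hR t) = φ t := by
  refine (ContinuousLinearMap.extend_eq (elemLift hR φ hφ).toContinuousLinearMap
    (e := UniformSpace.Completion.toComplL (𝕜 := ℝ) (E := Elementary hR))
    UniformSpace.Completion.denseRange_coe
    (UniformSpace.Completion.isUniformInducing_coe _) (elemInd hR t)).trans ?_
  change Finsupp.linearCombination ℝ φ (Finsupp.single t (1 : ℝ)) = φ t
  simp

end Integrands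

/-! ### Gaussian Volterra processes -/

variable {Ω : Type*} [MeasurableSpace Ω] {P : Measure Ω} {T : ℝ}
  {G : Set.Icc (0 : ℝ) T → Ω → ℝ}

/-- A centered Gaussian process on `[0,T]`, as a family of random variables. -/
structure IsCenteredGaussian (P : Measure Ω) (G : Set.Icc (0 : ℝ) T → Ω → ℝ) : Prop where
  measurable : ∀ t, Measurable (G t)
  gaussian : IsGaussianProcess G P
  centered : ∀ t, ∫ ω, G t ω ∂P = 0

/-- The covariance function `R(t,s)`. -/
def covFun (P : Measure Ω) (G : Set.Icc (0 : ℝ) T → Ω → ℝ) :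
    Matrix (Set.Icc (0 : ℝ) T) (Set.Icc (0 : ℝ) T) ℝ :=
  fun t s => cov[G t, G s; P]

lemma IsCenteredGaussian.memLp (hG : IsCenteredGaussian P G) (t : Set.Icc (0 : ℝ) T) :
    MemLp (G t) 2 P :=
  (hG.gaussian.hasGaussianLaw_eval t).memLp_two

/-- `G_t` as an element of `L²(Ω, P)`. -/
def IsCenteredGaussian.toL2 (hG : IsCenteredGaussian P G) (t : Set.Icc (0 : ℝ) T) : Lp ℝ 2 P :=
  (hG.memLp t).toLp (G t)

lemma IsCenteredGaussian.inner_toL2 (hG : IsCenteredGaussian P G) (t s : Set.Icc (0 : ℝ) T) :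
    ⟪hG.toL2 t, hG.toL2 s⟫ = covFun P G t s := by
  rw [L2.inner_def, covFun, covariance, hG.centered t, hG.centered s]
  refine integral_congr_ae ?_
  filter_upwards [(hG.memLp t).coeFn_toLp, (hG.memLp s).coeFn_toLp] with ω h1 h2
  simp only [IsCenteredGaussian.toL2, h1, h2, sub_zero]
  simp [mul_comm]

lemma IsCenteredGaussian.posSemidef (hG : IsCenteredGaussian P G) :
    (covFun P G).PosSemidef := by
  refine ⟨?_, fun x => ?_⟩
  · ext t s
    simpa [covFun] using covariance_comm (G s) (G t)
  · change 0 ≤ form (covFun P G) x x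
    rw [← form_linearCombination hG.toL2 hG.inner_toL2 x x]
    exact real_inner_self_nonneg

/-- The abstract Wiener integral `f ↦ ∫₀ᵀ f dG`, the isometry `Λ → L²(Ω, P)` extending
`1_t ↦ G_t`. For `f ∈ Λ_u` it is also written `∫₀ᵘ f dG`. -/
def IsCenteredGaussian.wiener (hG : IsCenteredGaussian P G) :
    Lambda hG.posSemidef →ₗᵢ[ℝ] Lp ℝ 2 P :=
  lift hG.posSemidef hG.toL2 hG.inner_toL2

/-- The σ-algebra `F^G_u` generated by `G_r`, `r ≤ u`. -/
abbrev IsCenteredGaussian.past (hG : IsCenteredGaussian P G) (u : Set.Icc (0 : ℝ) T) :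
    MeasurableSpace Ω :=
  Filtration.natural G (fun t => (hG.measurable t).stronglyMeasurable) u

/-- The Lebesgue-Stieltjes measure `dv` on `[0,T]` of an increasing `v : [0,T] → ℝ` (extended by
constants outside `[0,T]`): `dv [0,t) = v(t-) - v(0)` for `t > 0`. -/
def dv (hT : 0 < T) (v : Set.Icc (0 : ℝ) T →o ℝ) : Measure (Set.Icc (0 : ℝ) T) :=
  (v.monotone.IccExtend (h := hT.le)).stieltjesFunction.measure.comap Subtype.val

instance (hT : 0 < T) (v : Set.Icc (0 : ℝ) T →o ℝ) : IsFiniteMeasure (dv hT v) where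
  measure_univ_lt_top := by
    rw [dv, (MeasurableEmbedding.subtype_coe measurableSet_Icc).comap_apply]
    refine lt_of_le_of_lt (measure_mono ?_) (isCompact_Icc (a := (0 : ℝ)) (b := T)).measure_lt_top
    rintro _ ⟨x, _, rfl⟩
    exact x.2

/-- The covariance of `G` has the Volterra form `R(t,s) = ∫₀^{t∧s} K(t,x) K(s,x) dv(x)` with a
Volterra kernel `K` such that `∫₀ᵗ K(t,x)² dv(x) < ∞`. In accordance with `1_t = 1_{[0,t)}`, the
integral `∫₀ᵗ … dv` is over `[0,t)`, which makes a difference only if `v` jumps at `t`. -/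
structure HasVolterraCov (P : Measure Ω) (hT : 0 < T) (G : Set.Icc (0 : ℝ) T → Ω → ℝ)
    (v : Set.Icc (0 : ℝ) T →o ℝ) (K : Set.Icc (0 : ℝ) T → Set.Icc (0 : ℝ) T → ℝ) : Prop where
  volterra : ∀ t s, t < s → K t s = 0
  memLp : ∀ t, MemLp (K t) 2 ((dv hT v).restrict (Set.Iio t))
  cov_eq : ∀ t s, covFun P G t s = ∫ x in Set.Iio (min t s), K t x * K s x ∂(dv hT v)

section Kernel

variable {hT : 0 < T} {v : Set.Icc (0 : ℝ) T →o ℝ}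
  {K : Set.Icc (0 : ℝ) T → Set.Icc (0 : ℝ) T → ℝ}

lemma HasVolterraCov.memLp_indicator (hK : HasVolterraCov P hT G v K) (t : Set.Icc (0 : ℝ) T) :
    MemLp ((Set.Iio t).indicator (K t)) 2 (dv hT v) :=
  (memLp_indicator_iff_restrict measurableSet_Iio).2 (hK.memLp t)

/-- `K(t,·)` as an element of `L²([0,T], dv)`. (As `K(t,s) = 0` for `s > t`, the restriction to
`[0,t)` only concerns the point `s = t`, which is `dv`-null unless `v` jumps there.) -/
def HasVolterraCov.kernel (hK : HasVolterraCov P hT G v K) (t : Set.Icc (0 : ℝ) T) :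
    Lp ℝ 2 (dv hT v) :=
  (hK.memLp_indicator t).toLp _

lemma HasVolterraCov.inner_kernel (hK : HasVolterraCov P hT G v K) (t s : Set.Icc (0 : ℝ) T) :
    ⟪hK.kernel t, hK.kernel s⟫ = covFun P G t s := by
  rw [L2.inner_def, hK.cov_eq, ← integral_indicator measurableSet_Iio]
  refine integral_congr_ae ?_
  filter_upwards [(hK.memLp_indicator t).coeFn_toLp, (hK.memLp_indicator s).coeFn_toLp]
    with x h1 h2
  simp only [HasVolterraCov.kernel, h1, h2]
  by_cases ht : x < t <;> by_cases hs : x < s <;> simp [ht, hs, Set.indicator, mul_comm]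

/-- The adjoint associated operator `K* : Λ → L²([0,T], dv)`, the isometry extending
`1_t ↦ K(t,·)`. -/
def HasVolterraCov.adjointOp (hK : HasVolterraCov P hT G v K) (hG : IsCenteredGaussian P G) :
    Lambda hG.posSemidef →ₗᵢ[ℝ] Lp ℝ 2 (dv hT v) :=
  lift hG.posSemidef hK.kernel hK.inner_kernel

/-- The inverse `(K*)⁻¹` of the (injective) operator `K*`; only meaningful on the range of `K*`. -/
def HasVolterraCov.adjointInv (hK : HasVolterraCov P hT G v K) (hG : IsCenteredGaussian P G) :
    Lp ℝ 2 (dv hT v) → Lambda hG.posSemidef :=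
  Function.invFun (hK.adjointOp hG)

lemma HasVolterraCov.memLp_diff (hK : HasVolterraCov P hT G v K) {u t : Set.Icc (0 : ℝ) T}
    (hut : u ≤ t) :
    MemLp ((Set.Iio u).indicator fun x => K t x - K u x) 2 (dv hT v) :=
  (memLp_indicator_iff_restrict measurableSet_Iio).2
    (((hK.memLp t).mono_measure
      (Measure.restrict_mono (Set.Iio_subset_Iio hut) le_rfl)).sub (hK.memLp u))

/-- `1_u(·) [K(t,·) - K(u,·)]` as an element of `L²([0,T], dv)`. -/
def HasVolterraCov.diff (hK : HasVolterraCov P hT G v K) {u t : Set.Icc (0 : ℝ) T}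
    (hut : u ≤ t) : Lp ℝ 2 (dv hT v) :=
  (hK.memLp_diff hut).toLp _

/-- `Ψ(t,·|u) = (K*)⁻¹ [1_u (K(t,·) - K(u,·))]`. -/
def HasVolterraCov.Psi (hK : HasVolterraCov P hT G v K) (hG : IsCenteredGaussian P G)
    {u t : Set.Icc (0 : ℝ) T} (hut : u ≤ t) : Lambda hG.posSemidef :=
  hK.adjointInv hG (hK.diff hut)

end Kernel

/-- Gaussian Volterra processes: the covariance has the Volterra form with respect to `v` and `K`,
and for each `t` the equation `K*[K⁻¹(t,·)] = 1_t` in `L²([0,T], dv)` has a solution `K⁻¹(t,·)`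
which is an integrand on `[0,t]`. -/
structure IsGaussianVolterra (P : Measure Ω) (hT : 0 < T) (G : Set.Icc (0 : ℝ) T → Ω → ℝ)
    (v : Set.Icc (0 : ℝ) T →o ℝ) (K : Set.Icc (0 : ℝ) T → Set.Icc (0 : ℝ) T → ℝ) : Prop where
  gauss : IsCenteredGaussian P G
  cov : HasVolterraCov P hT G v K
  solvable : ∀ t, ∃ k ∈ LambdaUpTo gauss.posSemidef t, cov.adjointOp gauss k =
    indicatorConstLp 2 (measurableSet_Iio (a := t)) (measure_ne_top (dv hT v) _) (1 : ℝ)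

/-- The conditional covariance `E[(X - E[X|m]) (Y - E[Y|m]) | m]`. -/
def condCov (P : Measure Ω) (m : MeasurableSpace Ω) (X Y : Ω → ℝ) : Ω → ℝ :=
  P[fun ω => (X ω - (P[X | m]) ω) * (Y ω - (P[Y | m]) ω) | m]

end Volterra

end

/-! ### The range of `K*`. -/

namespace Volterra

/-! Everything takes place in `Λ`, which `K*` embeds isometrically in `L²(dv)` and the Wiener
integral embeds in `L²(P)`. By solvability the image of `Λ_u` under `K*` contains every `1_[0,r)`
with `r ≤ u`. These are total among the functions supported in `[0,u)`, and the image is closed, so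
it contains all such functions (`exists_adjointOp_eq`). Hence `Ψ(t,·|u)` exists and lies in `Λ_u`.
Write `1_t = 1_u + Ψ + ρ`. Then `K* ρ = K(t,·) 1_[u,t)`, whose support is disjoint from that of
every `K* 1_r` with `r ≤ u`, so `ρ ⊥ Λ_u`. Wiener integrals are jointly Gaussian
(`isGaussianProcess_wiener`), so orthogonality means independence of the past
(`indepFun_innovations`). Thus `G_t` is a part measurable with respect to the past (up to null sets)
plus an independent centered Gaussian. The mean is the first part, the covariances are the inner
products of the residuals `ρ` computed in `L²(dv)`, and the law is a shifted normal. -/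

/-- An integrable function whose integrals over the intervals `(-∞, r)`, `r ≤ u`, vanish is zero
almost everywhere on `(-∞, u)`. -/
lemma ae_restrict_Iio_eq_zero {α : Type*} [LinearOrder α] [TopologicalSpace α] [OrderTopology α]
    [SecondCountableTopology α] [MeasurableSpace α] [BorelSpace α] {μ : Measure α}
    [SigmaFinite μ] {f : α → ℝ} (hf : Integrable f μ) (u : α)
    (h : ∀ r ≤ u, ∫ x in Set.Iio r, f x ∂μ = 0) : f =ᵐ[μ.restrict (Set.Iio u)] 0 := by
  have hfu : Integrable f (μ.restrict (Set.Iio u)) := hf.restrict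
  refine ae_eq_zero_of_forall_setIntegral_eq_of_sigmaFinite (fun _ _ _ => hfu.integrableOn)
    fun s hs hsμ => ?_
  -- Kept in context, the finiteness of `s` would become a premise of the induction hypotheses.
  clear hsμ
  induction s, hs using MeasurableSpace.induction_on_inter
    ((BorelSpace.measurable_eq (α := α)).trans (borel_eq_generateFrom_Iio α)) isPiSystem_Iio with
  | empty => simp
  | basic s hs =>
    obtain ⟨r, rfl⟩ := hs
    rw [Measure.restrict_restrict measurableSet_Iio, Set.Iio_inter_Iio]
    exact h _ (min_le_right _ _)
  | compl s hs ih =>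
    -- Complements are covered because the case `r = u` makes the total integral vanish.
    have := integral_add_compl hs hfu
    rw [h u le_rfl] at this
    simp_all
  | iUnion s hd hm ih =>
    rw [integral_iUnion hm hd hfu.integrableOn]
    simp [ih]

section Range

variable {Ω : Type*} [MeasurableSpace Ω] {P : Measure Ω} {T : ℝ} {hT : 0 < T}
  {G : Set.Icc (0 : ℝ) T → Ω → ℝ} {v : Set.Icc (0 : ℝ) T →o ℝ}
  {K : Set.Icc (0 : ℝ) T → Set.Icc (0 : ℝ) T → ℝ}

lemma LambdaUpTo_mono {ι : Type*} [Preorder ι] {R : Matrix ι ι ℝ} (hR : R.PosSemidef) {r u : ι}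
    (hru : r ≤ u) : LambdaUpTo hR r ≤ LambdaUpTo hR u :=
  Submodule.topologicalClosure_mono
    (Submodule.span_mono (Set.image_mono (Set.Iic_subset_Iic.2 hru)))

lemma ind_mem_LambdaUpTo {ι : Type*} [Preorder ι] {R : Matrix ι ι ℝ} (hR : R.PosSemidef) {r u : ι}
    (hru : r ≤ u) : ind hR r ∈ LambdaUpTo hR u :=
  Submodule.le_topologicalClosure _ (Submodule.subset_span ⟨r, hru, rfl⟩)

/-- Every function in `L²(dv)` that vanishes off `[0,u)` is the image under `K*` of an integrand
on `[0,u]`. -/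
lemma IsGaussianVolterra.exists_adjointOp_eq (h : IsGaussianVolterra P hT G v K)
    (u : Set.Icc (0 : ℝ) T) {g : Lp ℝ 2 (dv hT v)}
    (hg : ∀ᵐ x ∂(dv hT v), x ∉ Set.Iio u → g x = 0) :
    ∃ f ∈ LambdaUpTo h.gauss.posSemidef u, h.cov.adjointOp h.gauss f = g := by
  -- `M` is complete, being the isometric image of a closed subspace, so `M = Mᗮᗮ` and it suffices
  -- that `g` is orthogonal to `Mᗮ`.
  set M := (LambdaUpTo h.gauss.posSemidef u).map (h.cov.adjointOp h.gauss).toLinearMap with hM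
  have hcomplete : IsComplete (M : Set (Lp ℝ 2 (dv hT v))) := by
    exact (h.cov.adjointOp h.gauss).isComplete_map_iff.2
      (Submodule.isClosed_topologicalClosure _).isComplete
  have : CompleteSpace M := hcomplete.completeSpace_coe
  suffices g ∈ M from this
  rw [← Submodule.orthogonal_orthogonal M, Submodule.mem_orthogonal]
  intro f hf
  have hzero : f =ᵐ[(dv hT v).restrict (Set.Iio u)] 0 := by
    refine ae_restrict_Iio_eq_zero ((Lp.memLp f).integrable one_le_two) u fun r hr => ?_
    obtain ⟨k, hk, hkr⟩ := h.solvable r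
    -- `K⁻¹(r,·) ∈ Λ_r ⊆ Λ_u` puts `1_[0,r)` in `M`, so the integral of `f` over `[0,r)` vanishes.
    have := (Submodule.mem_orthogonal _ _).1 hf _ ⟨k, LambdaUpTo_mono _ hr hk, rfl⟩
    change ⟪h.cov.adjointOp h.gauss k, f⟫ = 0 at this
    rwa [hkr, L2.inner_indicatorConstLp_one] at this
  rw [L2.inner_def]
  refine integral_eq_zero_of_ae ?_
  filter_upwards [hg, (ae_restrict_iff' measurableSet_Iio).1 hzero] with x h1 h2
  by_cases hx : x ∈ Set.Iio u
  · simp [h2 hx]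
  · simp [h1 hx]

end Range

end Volterra

/-! ### Gaussian laws in `L²` and conditioning on an independent variable. -/

namespace ProbabilityTheory

section Gaussian

variable {Ω : Type*} [MeasurableSpace Ω] {P : Measure Ω}

lemma integral_norm_le_norm_L2 [IsProbabilityMeasure P] (g : Lp ℝ 2 P) : ∫ ω, ‖g ω‖ ∂P ≤ ‖g‖ := by
  rw [Lp.norm_def, integral_norm_eq_lintegral_enorm (Lp.aestronglyMeasurable g),
    ← eLpNorm_one_eq_lintegral_enorm]
  exact ENNReal.toReal_mono (Lp.eLpNorm_ne_top g)
    (eLpNorm_le_eLpNorm_of_exponent_le one_le_two (Lp.aestronglyMeasurable g))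

lemma charFun_map_Lp (g : Lp ℝ 2 P) (t : ℝ) :
    charFun (P.map g) t = ∫ ω, Complex.exp (t * g ω * Complex.I) ∂P := by
  rw [charFun_apply_real, integral_map (Lp.aestronglyMeasurable g).aemeasurable (by fun_prop)]

/-- The map is Lipschitz with constant `|t|`, since `|e^{ia} - e^{ib}| ≤ |a - b|` and the `L¹` norm
is at most the `L²` norm. -/
lemma continuous_charFun_map_Lp [IsProbabilityMeasure P] (t : ℝ) :
    Continuous fun g : Lp ℝ 2 P => charFun (P.map g) t := by
  refine (LipschitzWith.of_dist_le_mul (K := ‖t‖₊) fun f g => ?_).continuous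
  have hint : ∀ g : Lp ℝ 2 P, Integrable (fun ω => Complex.exp (t * g ω * Complex.I)) P := by
    intro g
    refine Integrable.of_bound (C := 1) ?_ (.of_forall fun ω => ?_)
    · have := Lp.aestronglyMeasurable g
      fun_prop
    · rw [← Complex.ofReal_mul, Complex.norm_exp_ofReal_mul_I]
  have hL : Integrable (fun ω => ‖t‖ * ‖(f - g) ω‖) P :=
    ((Lp.memLp (f - g)).integrable one_le_two).norm.const_mul _
  rw [dist_eq_norm, dist_eq_norm, charFun_map_Lp, charFun_map_Lp,
    ← integral_sub (hint f) (hint g)]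
  calc ‖∫ ω, (Complex.exp (t * f ω * Complex.I) - Complex.exp (t * g ω * Complex.I)) ∂P‖
      ≤ ∫ ω, ‖t‖ * ‖(f - g) ω‖ ∂P := by
        refine norm_integral_le_of_norm_le hL ?_
        filter_upwards [Lp.coeFn_sub f g] with ω hω
        have key : Complex.exp (t * f ω * Complex.I) - Complex.exp (t * g ω * Complex.I)
            = Complex.exp ((t * g ω : ℝ) * Complex.I)
              * (Complex.exp (Complex.I * (t * (f ω - g ω) : ℝ)) - 1) := by
          rw [mul_sub, ← Complex.exp_add]
          push_cast
          ring_nf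
        rw [key, norm_mul, Complex.norm_exp_ofReal_mul_I, one_mul, hω, Pi.sub_apply, ← norm_mul]
        exact Real.norm_exp_I_mul_ofReal_sub_one_le
    _ ≤ ‖t‖ * ‖f - g‖ := by
        rw [integral_const_mul]
        gcongr
        exact integral_norm_le_norm_L2 _

/-- The centered Gaussian random variables form a closed subset of `L²`. -/
lemma isClosed_setOf_map_eq_gaussianReal [IsProbabilityMeasure P] :
    IsClosed {g : Lp ℝ 2 P | P.map g = gaussianReal 0 (‖g‖ ^ 2).toNNReal} := by
  -- Laws are determined by characteristic functions, so the set is an intersection over `t` of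
  -- conditions that are each closed by continuity.
  have : {g : Lp ℝ 2 P | P.map g = gaussianReal 0 (‖g‖ ^ 2).toNNReal} =
      ⋂ t : ℝ, {g : Lp ℝ 2 P | charFun (P.map g) t = Complex.exp (-((‖g‖ ^ 2 : ℝ) * t ^ 2 / 2))} := by
    ext g
    have hP : IsProbabilityMeasure (P.map g) :=
      Measure.isProbabilityMeasure_map (Lp.aestronglyMeasurable g).aemeasurable
    simp only [Set.mem_ofPred_eq, Set.mem_iInter]
    have hg : ∀ t : ℝ, charFun (gaussianReal 0 (‖g‖ ^ 2).toNNReal) t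
        = Complex.exp (-((‖g‖ ^ 2 : ℝ) * t ^ 2 / 2)) := by
      intro t
      rw [charFun_gaussianReal, Real.coe_toNNReal _ (sq_nonneg _)]
      simp
    refine ⟨fun h t => by rw [h, hg], fun h => Measure.ext_of_charFun ?_⟩
    ext t
    rw [h, hg]
  rw [this]
  exact isClosed_iInter fun t => isClosed_eq (continuous_charFun_map_Lp t) (by fun_prop)

lemma norm_sq_eq_integral (g : Lp ℝ 2 P) : ‖g‖ ^ 2 = ∫ ω, g ω ^ 2 ∂P := by
  rw [← real_inner_self_eq_norm_sq, L2.inner_def]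
  simp [sq]

lemma HasGaussianLaw.map_eq_of_centered {g : Lp ℝ 2 P} (hg : HasGaussianLaw g P)
    (h0 : ∫ ω, g ω ∂P = 0) : P.map g = gaussianReal 0 (‖g‖ ^ 2).toNNReal := by
  rw [hg.map_eq_gaussianReal, h0, variance_of_integral_eq_zero hg.aemeasurable h0,
    norm_sq_eq_integral]

/-- If `X` and `Y` are independent then the conditional law of `g(X) + Y` given `X` is the law
of `Y` shifted by `g(X)`. -/
lemma condExp_indicator_add_of_indepFun [IsProbabilityMeasure P] {β : Type*} [mβ : MeasurableSpace β] {X : Ω → β}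
    {Y : Ω → ℝ} {g : β → ℝ} (hX : Measurable X) (hY : AEMeasurable Y P) (hg : Measurable g)
    (hXY : IndepFun X Y P) {B : Set ℝ} (hB : MeasurableSet B) :
    P[((fun ω => g (X ω) + Y ω) ⁻¹' B).indicator (fun _ => (1 : ℝ)) | mβ.comap X] =ᵐ[P]
      fun ω => ((P.map Y).map (g (X ω) + ·)).real B := by
  have : IsProbabilityMeasure (P.map Y) := Measure.isProbabilityMeasure_map hY
  have : IsProbabilityMeasure (P.map X) := Measure.isProbabilityMeasure_map hX.aemeasurable
  -- Independence factors the joint law as a product, so the conditional distribution of `Y` given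
  -- `X` is the constant kernel.
  have hlaw : condDistrib Y X P =ᵐ[P.map X] Kernel.const β (P.map Y) := by
    refine condDistrib_ae_eq_of_measure_eq_compProd X hY ?_
    rw [(indepFun_iff_map_prod_eq_prod_map_map hX.aemeasurable hY).1 hXY, Measure.compProd_const]
  set F : β × ℝ → ℝ := ((fun p : β × ℝ => g p.1 + p.2) ⁻¹' B).indicator fun _ => 1 with hF
  have hS : MeasurableSet ((fun p : β × ℝ => g p.1 + p.2) ⁻¹' B) :=
    (by fun_prop : Measurable fun p : β × ℝ => g p.1 + p.2) hB
  have hFm : Measurable F := measurable_const.indicator hS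
  have hFi : Integrable F (P.map fun a => (X a, Y a)) :=
    have : IsProbabilityMeasure (P.map fun a => (X a, Y a)) :=
      Measure.isProbabilityMeasure_map (hX.aemeasurable.prodMk hY)
    (integrable_const 1).indicator hS
  refine (condExp_prod_ae_eq_integral_condDistrib' hX hY hFi).trans ?_
  filter_upwards [ae_of_ae_map hX.aemeasurable hlaw] with ω hω
  rw [hω, Kernel.const_apply, map_measureReal_apply (measurable_const_add _) hB]
  exact integral_indicator_one (measurable_const_add (g (X ω)) hB)

end Gaussian

end ProbabilityTheory

/-! ### The Wiener integral as a Gaussian process. -/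

namespace Volterra

section Wiener

lemma lift_coe {ι H : Type*} {R : Matrix ι ι ℝ} [NormedAddCommGroup H] [InnerProductSpace ℝ H]
    [CompleteSpace H] (hR : R.PosSemidef) (φ : ι → H) (hφ : ∀ t s, ⟪φ t, φ s⟫ = R t s)
    (e : ι →₀ ℝ) :
    lift hR φ hφ ((show Elementary hR from e : Elementary hR) : Lambda hR)
      = Finsupp.linearCombination ℝ φ e :=
  ContinuousLinearMap.extend_eq (elemLift hR φ hφ).toContinuousLinearMap
    (e := UniformSpace.Completion.toComplL (𝕜 := ℝ) (E := Elementary hR))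
    UniformSpace.Completion.denseRange_coe
    (UniformSpace.Completion.isUniformInducing_coe _) (show Elementary hR from e)

variable {Ω : Type*} [MeasurableSpace Ω] {P : Measure Ω} {T : ℝ}
  {G : Set.Icc (0 : ℝ) T → Ω → ℝ}

lemma IsCenteredGaussian.wiener_ind (hG : IsCenteredGaussian P G) (t : Set.Icc (0 : ℝ) T) :
    hG.wiener (ind hG.posSemidef t) =ᵐ[P] G t := by
  rw [wiener, lift_ind]
  exact (hG.memLp t).coeFn_toLp

/-- The Wiener integral of `f` has the law `N(0, ‖f‖²)`. -/
lemma IsCenteredGaussian.map_wiener [IsProbabilityMeasure P] (hG : IsCenteredGaussian P G) (f : Lambda hG.posSemidef) :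
    P.map (hG.wiener f) = gaussianReal 0 (‖f‖ ^ 2).toNNReal := by
  rw [← hG.wiener.norm_map f]
  -- The claim is a closed condition on `f`, so finite sums `∑ c_i G_i` suffice; these are Gaussian
  -- by hypothesis.
  refine UniformSpace.Completion.induction_on f
    (isClosed_setOf_map_eq_gaussianReal.preimage hG.wiener.continuous) fun e => ?_
  have hsum : ∀ s : Finset (Set.Icc (0 : ℝ) T), ∀ c : Set.Icc (0 : ℝ) T → ℝ,
      ((∑ i ∈ s, c i • hG.toL2 i : Lp ℝ 2 P) : Ω → ℝ) =ᵐ[P] fun ω => ∑ i ∈ s, c i * G i ω := by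
    intro s c
    have hall : ∀ᵐ ω ∂P, ∀ i ∈ s, (c i • hG.toL2 i : Lp ℝ 2 P) ω = c i * G i ω := by
      rw [Filter.eventually_all_finset]
      intro i _
      filter_upwards [Lp.coeFn_smul (c i) (hG.toL2 i), (hG.memLp i).coeFn_toLp] with ω h1 h2
      rw [h1, Pi.smul_apply, toL2, h2, smul_eq_mul]
    filter_upwards [Lp.coeFn_finsetSum s fun i => c i • hG.toL2 i, hall] with ω h1 h2
    rw [h1, Finset.sum_apply]
    exact Finset.sum_congr rfl h2
  have he : hG.wiener e = ∑ i ∈ Finsupp.support e, (show Set.Icc (0 : ℝ) T →₀ ℝ from e) i • hG.toL2 i :=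
    lift_coe hG.posSemidef hG.toL2 hG.inner_toL2 e
  have hae := he ▸ hsum (Finsupp.support e) (show Set.Icc (0 : ℝ) T →₀ ℝ from e)
  refine HasGaussianLaw.map_eq_of_centered ?_ ?_
  · refine HasGaussianLaw.congr ?_ hae.symm
    exact (hG.gaussian.smul (show Set.Icc (0 : ℝ) T →₀ ℝ from e)).hasGaussianLaw_fun_sum
  · rw [integral_congr_ae hae, integral_finsetSum _ fun i _ =>
      ((hG.memLp i).integrable one_le_two).const_mul _]
    simp [integral_const_mul, hG.centered]

lemma IsCenteredGaussian.integral_wiener [IsProbabilityMeasure P] (hG : IsCenteredGaussian P G)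
    (f : Lambda hG.posSemidef) : ∫ ω, hG.wiener f ω ∂P = 0 := by
  have := integral_map (Lp.aestronglyMeasurable (hG.wiener f)).aemeasurable
    (f := fun x : ℝ => x) (by fun_prop)
  rw [← this, hG.map_wiener, integral_id_gaussianReal]

lemma IsCenteredGaussian.integral_wiener_mul (hG : IsCenteredGaussian P G)
    (f g : Lambda hG.posSemidef) :
    ∫ ω, hG.wiener f ω * hG.wiener g ω ∂P = ⟪f, g⟫ := by
  rw [← hG.wiener.inner_map_map f g, L2.inner_def]
  simp [mul_comm]

lemma IsCenteredGaussian.covariance_wiener [IsProbabilityMeasure P] (hG : IsCenteredGaussian P G)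
    (f g : Lambda hG.posSemidef) : cov[hG.wiener f, hG.wiener g; P] = ⟪f, g⟫ := by
  rw [covariance, hG.integral_wiener, hG.integral_wiener, ← hG.integral_wiener_mul]
  simp

/-- The Wiener integrals form a Gaussian process. -/
lemma IsCenteredGaussian.isGaussianProcess_wiener [IsProbabilityMeasure P] (hG : IsCenteredGaussian P G) :
    IsGaussianProcess (fun f : Lambda hG.posSemidef => (hG.wiener f : Ω → ℝ)) P where
  hasGaussianLaw I := by
    refine ⟨isGaussian_of_isGaussian_map fun L => ?_⟩
    have hm : Measurable fun ω => I.restrict fun f => (hG.wiener f : Ω → ℝ) ω :=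
      measurable_pi_lambda _ fun f => (Lp.stronglyMeasurable _).measurable
    rw [Measure.map_map (by fun_prop) hm]
    classical
    -- The `c i` are the values of `L` on the coordinate vectors. By linearity `L` of the family is
    -- the single Wiener integral of `∑ c_i f_i`, whose law is already known.
    set c : I → ℝ := fun i => L fun j => if i = j then 1 else 0
    have hae : hG.wiener (∑ i, c i • (i : Lambda hG.posSemidef)) =ᵐ[P]
        L ∘ fun ω => I.restrict fun f => (hG.wiener f : Ω → ℝ) ω := by
      have hall : ∀ᵐ ω ∂P, ∀ i : I, (c i • hG.wiener i : Lp ℝ 2 P) ω = c i * hG.wiener i ω :=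
        ae_all_iff.2 fun i => Lp.coeFn_smul (c i) (hG.wiener i)
      rw [map_sum]
      simp only [map_smul]
      filter_upwards [Lp.coeFn_finsetSum Finset.univ fun i : I => c i • hG.wiener i, hall]
        with ω h1 h2
      rw [h1, Finset.sum_apply, Function.comp_apply, ← L.coe_coe, L.toLinearMap.pi_apply_eq_sum_univ]
      simp only [h2]
      refine Finset.sum_congr rfl fun i _ => ?_
      rw [smul_eq_mul, mul_comm]
      rfl
    rw [← Measure.map_congr hae, hG.map_wiener]
    infer_instance

end Wiener

end Volterra

/-! ### Independence of the past, and prediction. -/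

namespace Volterra

section Prediction

variable {Ω : Type*} [MeasurableSpace Ω] {P : Measure Ω} {T : ℝ} {hT : 0 < T}
  {G : Set.Icc (0 : ℝ) T → Ω → ℝ} {v : Set.Icc (0 : ℝ) T →o ℝ}
  {K : Set.Icc (0 : ℝ) T → Set.Icc (0 : ℝ) T → ℝ}

lemma IsCenteredGaussian.past_le (hG : IsCenteredGaussian P G) (u : Set.Icc (0 : ℝ) T) :
    hG.past u ≤ ‹MeasurableSpace Ω› :=
  Filtration.le _ u

lemma IsCenteredGaussian.past_eq_comap (hG : IsCenteredGaussian P G) (u : Set.Icc (0 : ℝ) T) :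
    hG.past u = MeasurableSpace.comap (fun ω (r : Set.Iic u) => G r ω) inferInstance :=
  Filtration.natural_eq_comap _ _ _

/-- Wiener integrals of integrands on `[0,u]` are measurable with respect to the past of `u`. -/
lemma IsCenteredGaussian.aestronglyMeasurable_wiener (hG : IsCenteredGaussian P G)
    {u : Set.Icc (0 : ℝ) T} {f : Lambda hG.posSemidef} (hf : f ∈ LambdaUpTo hG.posSemidef u) :
    AEStronglyMeasurable[hG.past u] (hG.wiener f) P := by
  -- The integrands with past-measurable integral form a closed subspace, so it is enough that it
  -- contains the `1_r`, `r ≤ u`.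
  let S : Submodule ℝ (Lambda hG.posSemidef) :=
    (lpMeas ℝ ℝ (hG.past u) 2 P).comap hG.wiener.toLinearMap
  have hclosed : IsClosed (S : Set (Lambda hG.posSemidef)) :=
    (isClosed_aestronglyMeasurable (F := ℝ) (p := 2) (hG.past_le u)).preimage hG.wiener.continuous
  have hle : LambdaUpTo hG.posSemidef u ≤ S := by
    refine Submodule.topologicalClosure_minimal _ (Submodule.span_le.2 ?_) hclosed
    rintro _ ⟨r, hr, rfl⟩
    change hG.wiener (ind hG.posSemidef r) ∈ lpMeas ℝ ℝ (hG.past u) 2 P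
    rw [mem_lpMeas_iff_aestronglyMeasurable]
    have hGr : Measurable[hG.past u] (G r) := by
      rw [hG.past_eq_comap]
      exact (measurable_pi_apply (⟨r, hr⟩ : Set.Iic u)).comp
        (comap_measurable fun ω (r : Set.Iic u) => G r ω)
    exact (hGr.stronglyMeasurable.aestronglyMeasurable).congr (hG.wiener_ind r).symm
  exact (mem_lpMeas_iff_aestronglyMeasurable (𝕜 := ℝ)).1 (hle hf)

/-- The integrands orthogonal to `1_r`, `r ≤ u`. -/
def innovations (hG : IsCenteredGaussian P G) (u : Set.Icc (0 : ℝ) T) :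
    Set (Lambda hG.posSemidef) :=
  {f | ∀ r ≤ u, ⟪ind hG.posSemidef r, f⟫ = 0}

/-- The Wiener integrals of integrands orthogonal to the past are jointly independent of it. -/
lemma IsCenteredGaussian.indepFun_innovations (hG : IsCenteredGaussian P G)
    (u : Set.Icc (0 : ℝ) T) :
    IndepFun (fun ω (r : Set.Iic u) => G r ω)
      (fun ω (f : innovations hG u) => (hG.wiener f : Ω → ℝ) ω) P := by
  have := hG.gaussian.isProbabilityMeasure
  refine IsGaussianProcess.indepFun_of_covariance_eq_zero (X := fun (r : Set.Iic u) => G r)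
    (Y := fun f : innovations hG u => (hG.wiener f : Ω → ℝ)) ?_
    (fun r => (hG.measurable r).aemeasurable)
    (fun f => (Lp.aestronglyMeasurable _).aemeasurable) fun r f => ?_
  -- Joint Gaussianity: since `G_r` is a.s. the Wiener integral of `1_r`, both families together are
  -- a reindexing of the Wiener process up to null sets.
  · refine (hG.isGaussianProcess_wiener.comp_right
      (Sum.elim (fun r : Set.Iic u => ind hG.posSemidef r) Subtype.val)).congr ?_
    rintro (r | f)
    · exact hG.wiener_ind r
    · rfl
  · have hr : cov[G r, hG.wiener f; P] = cov[hG.wiener (ind hG.posSemidef r), hG.wiener f; P] := by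
      rw [covariance, covariance, integral_congr_ae (hG.wiener_ind r)]
      refine integral_congr_ae ?_
      filter_upwards [hG.wiener_ind r] with ω hω
      rw [hω]
    rw [hr, hG.covariance_wiener]
    exact f.2 r r.2

/-- The part of `1_t` orthogonal to the past of `u`. -/
noncomputable def IsGaussianVolterra.residual (h : IsGaussianVolterra P hT G v K) {u t : Set.Icc (0 : ℝ) T}
    (hut : u ≤ t) : Lambda h.gauss.posSemidef :=
  ind h.gauss.posSemidef t - ind h.gauss.posSemidef u - h.cov.Psi h.gauss hut

lemma IsGaussianVolterra.adjointOp_Psi (h : IsGaussianVolterra P hT G v K)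
    {u t : Set.Icc (0 : ℝ) T} (hut : u ≤ t) :
    h.cov.adjointOp h.gauss (h.cov.Psi h.gauss hut) = h.cov.diff hut ∧
      h.cov.Psi h.gauss hut ∈ LambdaUpTo h.gauss.posSemidef u := by
  obtain ⟨f, hf, hfd⟩ := h.exists_adjointOp_eq u (g := h.cov.diff hut) (by
    filter_upwards [(h.cov.memLp_diff hut).coeFn_toLp] with x hx hxu
    rw [HasVolterraCov.diff, hx, Set.indicator_of_notMem hxu])
  have hPsi : h.cov.adjointOp h.gauss (h.cov.Psi h.gauss hut) = h.cov.diff hut :=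
    Function.invFun_eq ⟨f, hfd⟩
  refine ⟨hPsi, ?_⟩
  -- Injectivity of `K*` identifies the preimage picked by `invFun` with `f`.
  rwa [(h.cov.adjointOp h.gauss).injective (hPsi.trans hfd.symm)]

/-- The terms in `K(u,·)` cancel; as `u ≤ t`, what remains is `K(t,·) 1_[u,t)`. -/
lemma IsGaussianVolterra.adjointOp_residual (h : IsGaussianVolterra P hT G v K)
    {u t : Set.Icc (0 : ℝ) T} (hut : u ≤ t) :
    h.cov.adjointOp h.gauss (h.residual hut) =ᵐ[dv hT v]
      fun x => (Set.Iio t).indicator (K t) x - (Set.Iio u).indicator (K t) x := by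
  have hind : ∀ r, h.cov.adjointOp h.gauss (ind h.gauss.posSemidef r) = h.cov.kernel r :=
    fun r => lift_ind _ _ _ r
  rw [residual, map_sub, map_sub, hind, hind, (h.adjointOp_Psi hut).1]
  filter_upwards [Lp.coeFn_sub (h.cov.kernel t - h.cov.kernel u) (h.cov.diff hut),
    Lp.coeFn_sub (h.cov.kernel t) (h.cov.kernel u), (h.cov.memLp_diff hut).coeFn_toLp,
    (h.cov.memLp_indicator t).coeFn_toLp, (h.cov.memLp_indicator u).coeFn_toLp]
    with x h1 h2 h3 h4 h5
  rw [h1, Pi.sub_apply, h2, Pi.sub_apply, HasVolterraCov.diff, HasVolterraCov.kernel,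
    HasVolterraCov.kernel, h3, h4, h5]
  by_cases hx : x < u <;> simp [Set.indicator, hx]

/-- `K* 1_r` lives on `[0,r) ⊆ [0,u)` and the image of the residual on `[u,t)`, so the integrand of
their inner product is zero. -/
lemma IsGaussianVolterra.residual_mem_innovations (h : IsGaussianVolterra P hT G v K)
    {u t : Set.Icc (0 : ℝ) T} (hut : u ≤ t) : h.residual hut ∈ innovations h.gauss u := by
  intro r hr
  rw [← (h.cov.adjointOp h.gauss).inner_map_map,
    show h.cov.adjointOp h.gauss (ind h.gauss.posSemidef r) = h.cov.kernel r from lift_ind _ _ _ r,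
    L2.inner_def]
  refine integral_eq_zero_of_ae ?_
  filter_upwards [h.adjointOp_residual hut, (h.cov.memLp_indicator r).coeFn_toLp] with x h1 h2
  rw [h1, HasVolterraCov.kernel, h2]
  by_cases hx : x < r
  · simp [Set.indicator, hx, hx.trans_le hr, (hx.trans_le hr).trans_le hut]
  · simp [Set.indicator, hx]

/-- The inner products of the residuals are the conditional covariances. -/
lemma IsGaussianVolterra.inner_residual (h : IsGaussianVolterra P hT G v K)
    {u s t : Set.Icc (0 : ℝ) T} (hus : u ≤ s) (hut : u ≤ t) :
    ⟪h.residual hut, h.residual hus⟫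
      = covFun P G t s - ∫ x in Set.Iio u, K t x * K s x ∂(dv hT v) := by
  have hint : IntegrableOn (fun x => K t x * K s x) (Set.Iio (min t s)) (dv hT v) :=
    ((h.cov.memLp t).mono_measure (Measure.restrict_mono
      (Set.Iio_subset_Iio (min_le_left t s)) le_rfl)).integrable_mul
    ((h.cov.memLp s).mono_measure (Measure.restrict_mono
      (Set.Iio_subset_Iio (min_le_right t s)) le_rfl))
  have hint' := hint.mono_set (Set.Iio_subset_Iio (le_min hut hus))
  rw [← (h.cov.adjointOp h.gauss).inner_map_map, L2.inner_def, h.cov.cov_eq,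
    ← integral_indicator measurableSet_Iio, ← integral_indicator measurableSet_Iio,
    ← integral_sub (hint.integrable_indicator measurableSet_Iio)
      (hint'.integrable_indicator measurableSet_Iio)]
  refine integral_congr_ae ?_
  filter_upwards [h.adjointOp_residual hut, h.adjointOp_residual hus] with x h1 h2
  rw [h1, h2]
  by_cases hx : x < u
  · simp [Set.indicator, hx, hx.trans_le hut, hx.trans_le hus]
  · by_cases ht : x < t <;> by_cases hs : x < s <;> simp [Set.indicator, hx, ht, hs, mul_comm]

lemma IsGaussianVolterra.ae_eq_add_wiener_residual (h : IsGaussianVolterra P hT G v K)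
    {u t : Set.Icc (0 : ℝ) T} (hut : u ≤ t) :
    G t =ᵐ[P] fun ω => (G u ω + (h.gauss.wiener (h.cov.Psi h.gauss hut) : Ω → ℝ) ω)
      + (h.gauss.wiener (h.residual hut) : Ω → ℝ) ω := by
  have hres : h.gauss.wiener (h.residual hut) = h.gauss.wiener (ind h.gauss.posSemidef t)
      - h.gauss.wiener (ind h.gauss.posSemidef u) - h.gauss.wiener (h.cov.Psi h.gauss hut) := by
    rw [residual, map_sub, map_sub]
  rw [hres]
  filter_upwards [h.gauss.wiener_ind t, h.gauss.wiener_ind u,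
    Lp.coeFn_sub (h.gauss.wiener (ind h.gauss.posSemidef t)
      - h.gauss.wiener (ind h.gauss.posSemidef u)) (h.gauss.wiener (h.cov.Psi h.gauss hut)),
    Lp.coeFn_sub (h.gauss.wiener (ind h.gauss.posSemidef t))
      (h.gauss.wiener (ind h.gauss.posSemidef u))] with ω h1 h2 h3 h4
  rw [h3, Pi.sub_apply, h4, Pi.sub_apply, h1, h2]
  ring

/-- A measurable function of the innovations has a deterministic conditional expectation given
the past. -/
lemma IsCenteredGaussian.condExp_innovations (hG : IsCenteredGaussian P G)
    (u : Set.Icc (0 : ℝ) T) {F : (innovations hG u → ℝ) → ℝ} (hF : Measurable F) :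
    P[fun ω => F fun f => (hG.wiener f : Ω → ℝ) ω | hG.past u] =ᵐ[P]
      fun _ => ∫ ω, F (fun f => (hG.wiener f : Ω → ℝ) ω) ∂P := by
  have := hG.gaussian.isProbabilityMeasure
  have hm : Measurable fun ω (f : innovations hG u) => (hG.wiener f : Ω → ℝ) ω :=
    measurable_pi_lambda _ fun f => (Lp.stronglyMeasurable _).measurable
  refine condExp_indep_eq hm.comap_le (hG.past_le u)
    (hF.comp (comap_measurable _)).stronglyMeasurable ?_
  rw [hG.past_eq_comap]
  exact (IndepFun_iff_Indep _ _ _).1 (hG.indepFun_innovations u).symm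

lemma IsGaussianVolterra.condExp_eq (h : IsGaussianVolterra P hT G v K)
    {u t : Set.Icc (0 : ℝ) T} (hut : u ≤ t) :
    P[G t | h.gauss.past u] =ᵐ[P]
      fun ω => G u ω + (h.gauss.wiener (h.cov.Psi h.gauss hut) : Ω → ℝ) ω := by
  have := h.gauss.gaussian.isProbabilityMeasure
  have hW : ∀ f, Integrable (h.gauss.wiener f) P := fun f =>
    (Lp.memLp (h.gauss.wiener f)).integrable one_le_two
  have hGu : Integrable (G u) P := (h.gauss.memLp u).integrable one_le_two
  have hmean := condExp_of_aestronglyMeasurable' (h.gauss.past_le u)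
    (f := fun ω => G u ω + (h.gauss.wiener (h.cov.Psi h.gauss hut) : Ω → ℝ) ω)
    (((h.gauss.aestronglyMeasurable_wiener (ind_mem_LambdaUpTo _ le_rfl)).congr
      (h.gauss.wiener_ind u)).add
      (h.gauss.aestronglyMeasurable_wiener (h.adjointOp_Psi hut).2)) (hGu.add (hW _))
  have hres := h.gauss.condExp_innovations u
    (F := fun y => y ⟨h.residual hut, h.residual_mem_innovations hut⟩) (measurable_pi_apply _)
  -- The residual is centered, so it adds nothing to the conditional mean.
  simp only [h.gauss.integral_wiener] at hres
  filter_upwards [condExp_congr_ae (m := h.gauss.past u) (h.ae_eq_add_wiener_residual hut),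
    condExp_add (hGu.add (hW (h.cov.Psi h.gauss hut))) (hW (h.residual hut)) (h.gauss.past u),
    hmean, hres] with ω h1 h2 h3 h4
  refine h1.trans (h2.trans ?_)
  rw [Pi.add_apply]
  exact (congrArg₂ (· + ·) h3 h4).trans (add_zero _)

lemma IsGaussianVolterra.sub_condExp_eq (h : IsGaussianVolterra P hT G v K)
    {u t : Set.Icc (0 : ℝ) T} (hut : u ≤ t) :
    (fun ω => G t ω - (P[G t | h.gauss.past u]) ω) =ᵐ[P] h.gauss.wiener (h.residual hut) := by
  filter_upwards [h.ae_eq_add_wiener_residual hut, h.condExp_eq hut] with ω h1 h2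
  rw [h2, h1, add_sub_cancel_left]

lemma IsGaussianVolterra.condCov_eq (h : IsGaussianVolterra P hT G v K)
    {u s t : Set.Icc (0 : ℝ) T} (hus : u ≤ s) (hut : u ≤ t) :
    condCov P (h.gauss.past u) (G t) (G s) =ᵐ[P]
      fun _ => covFun P G t s - ∫ x in Set.Iio u, K t x * K s x ∂(dv hT v) := by
  have hres := h.gauss.condExp_innovations u
    (F := fun y => y ⟨h.residual hut, h.residual_mem_innovations hut⟩ *
      y ⟨h.residual hus, h.residual_mem_innovations hus⟩)
    ((measurable_pi_apply _).mul (measurable_pi_apply _))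
  simp only [h.gauss.integral_wiener_mul, h.inner_residual hus hut] at hres
  refine (condExp_congr_ae ?_).trans hres
  filter_upwards [h.sub_condExp_eq hut, h.sub_condExp_eq hus] with ω h1 h2
  rw [h1, h2]

lemma IsGaussianVolterra.condLaw_eq (h : IsGaussianVolterra P hT G v K)
    {u t : Set.Icc (0 : ℝ) T} (hut : u ≤ t) {B : Set ℝ} (hB : MeasurableSet B) :
    P[(G t ⁻¹' B).indicator (fun _ => (1 : ℝ)) | h.gauss.past u] =ᵐ[P]
      fun ω => (gaussianReal ((P[G t | h.gauss.past u]) ω)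
        (covFun P G t t - ∫ x in Set.Iio u, K t x * K t x ∂(dv hT v)).toNNReal).real B := by
  have := h.gauss.gaussian.isProbabilityMeasure
  have hX : Measurable fun ω (r : Set.Iic u) => G r ω :=
    measurable_pi_lambda _ fun r => h.gauss.measurable r
  -- Doob–Dynkin factorization through the path on `[0,u]`. It is applied to the conditional
  -- expectation, which is genuinely past-measurable, whereas measurability of `∫ Ψ dG` is only
  -- known up to null sets.
  obtain ⟨g, hg, hgX⟩ : ∃ g : (Set.Iic u → ℝ) → ℝ, Measurable g ∧
      P[G t | h.gauss.past u] = g ∘ fun ω (r : Set.Iic u) => G r ω := by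
    have hm : Measurable[h.gauss.past u] (P[G t | h.gauss.past u]) :=
      stronglyMeasurable_condExp.measurable
    -- Hides the σ-algebra inside the conditional expectation from the next rewrite.
    generalize P[G t | h.gauss.past u] = m at hm
    rw [h.gauss.past_eq_comap] at hm
    exact hm.exists_eq_measurable_comp
  have hind : IndepFun (fun ω (r : Set.Iic u) => G r ω) (h.gauss.wiener (h.residual hut)) P :=
    (h.gauss.indepFun_innovations u).comp measurable_id
      (measurable_pi_apply (⟨_, h.residual_mem_innovations hut⟩ : innovations h.gauss u))
  have hlaw := condExp_indicator_add_of_indepFun hX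
    (Lp.aestronglyMeasurable (h.gauss.wiener (h.residual hut))).aemeasurable hg hind hB
  rw [← h.gauss.past_eq_comap, h.gauss.map_wiener, ← real_inner_self_eq_norm_sq,
    h.inner_residual hut hut] at hlaw
  simp only [gaussianReal_map_const_add, zero_add] at hlaw
  rw [hgX]
  refine (condExp_congr_ae ?_).trans hlaw
  filter_upwards [h.sub_condExp_eq hut] with ω hω
  have hω' : g (fun r : Set.Iic u => G r ω) + h.gauss.wiener (h.residual hut) ω = G t ω := by
    rw [← hω, hgX, Function.comp_apply, add_sub_cancel]
  change B.indicator (fun _ => (1 : ℝ)) (G t ω) = B.indicator (fun _ => (1 : ℝ)) (_ + _)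
  rw [hω']

end Prediction

end Volterra


theorem proposition2p4 {Ω : Type*} [MeasurableSpace Ω] (P : Measure Ω) [IsProbabilityMeasure P]
    {T : ℝ} (hT : 0 < T) (G : Set.Icc (0 : ℝ) T → Ω → ℝ) (v : Set.Icc (0 : ℝ) T →o ℝ)
    (K : Set.Icc (0 : ℝ) T → Set.Icc (0 : ℝ) T → ℝ)
    (h : Volterra.IsGaussianVolterra P hT G v K)
    (u s t : Set.Icc (0 : ℝ) T) (hus : u ≤ s) (hst : s ≤ t) :
    -- `Ψ(t,·|u)` is well defined: it is an integrand on `[0,u]` and inverts `K*`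
    (h.cov.adjointOp h.gauss (h.cov.Psi h.gauss (hus.trans hst)) = h.cov.diff (hus.trans hst) ∧
      h.cov.Psi h.gauss (hus.trans hst) ∈ Volterra.LambdaUpTo h.gauss.posSemidef u) ∧
    -- conditional mean
    (P[G t | h.gauss.past u] =ᵐ[P]
      fun ω => G u ω + (h.gauss.wiener (h.cov.Psi h.gauss (hus.trans hst)) : Ω → ℝ) ω) ∧
    -- conditional covariance
    (Volterra.condCov P (h.gauss.past u) (G t) (G s) =ᵐ[P]
      fun _ => Volterra.covFun P G t s - ∫ x in Set.Iio u, K t x * K s x ∂(Volterra.dv hT v)) ∧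
    -- conditional law (a variance `0` gives the point mass)
    (0 ≤ Volterra.covFun P G t t - ∫ x in Set.Iio u, K t x * K t x ∂(Volterra.dv hT v) ∧
      ∀ B : Set ℝ, MeasurableSet B →
        P[(G t ⁻¹' B).indicator (fun _ => (1 : ℝ)) | h.gauss.past u] =ᵐ[P]
          fun ω => (gaussianReal ((P[G t | h.gauss.past u]) ω)
            (Volterra.covFun P G t t -
              ∫ x in Set.Iio u, K t x * K t x ∂(Volterra.dv hT v)).toNNReal).real B) := by
  refine ⟨h.adjointOp_Psi _, h.condExp_eq _, h.condCov_eq hus (hus.trans hst), ?_, fun B hB =>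
    h.condLaw_eq (hus.trans hst) hB⟩
  -- The variance is the squared norm of the residual.
  rw [← h.inner_residual (hus.trans hst) (hus.trans hst)]
  exact real_inner_self_nonneg
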